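/- Consider a downlink with an $N_t$-antenna transmitter and $K$ single-antenna power-splitting receivers, with channel vectors $\mathbf h_k\in\mathbb C^{N_t}$, antenna noise variance $N_0>0$, circuit noise variances $N_{C,k}>0$, SINR targets $\gamma_k>0$, required energy-harvester input powers $\lambda_k>0$, positive semidefinite Hermitian SAR matrices $\mathbf A_1,\dots,\mathbf A_L\in\mathbb C^{N_t\times N_t}$ and SAR limits $P_l\in\mathbb R$. Let (P2) be the problem $$\min_{\{\mathbf w_k,\rho_k\}}\ \sum_{k=1}^K\|\mathbf w_k\|^2\quad\text{s.t.}\quad \frac{|\mathbf h_k^\dagger\mathbf w_k|^2}{\sum_{j\ne k}|\mathbf h_k^\dagger\mathbf w_j|^2+N_0+\frac{N_{C,k}}{\rho_k}}\ge\gamma_k,\quad (1-\rho_k)\Big(\sum_{j=1}^K|\mathbf h_k^\dagger\mathbf w_j|^2+N_0\Big)\ge\lambda_k,\quad 0\le\rho_k\le1\ \ \forall k,\qquad \sum_{k=1}^K\mathbf w_k^\dagger\mathbf A_l\mathbf w_k\le P_l\ \ \forall l,$$ over $\mathbf w_k\in\mathbb C^{N_t}$, and let (P5) be its semidefinite relaxation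 $$\min_{\{\mathbf W_k,\rho_k\}}\ \sum_{k=1}^K\operatorname{tr}\mathbf W_k\quad\text{s.t.}\quad \frac{\operatorname{tr}(\mathbf h_k\mathbf h_k^\dagger\mathbf W_k)}{\sum_{j=1}^K\operatorname{tr}(\mathbf h_k\mathbf h_k^\dagger\mathbf W_j)+N_0+\frac{N_{C,k}}{\rho_k}}\ge\frac{\gamma_k}{1+\gamma_k},\quad \sum_{j=1}^K\operatorname{tr}(\mathbf h_k\mathbf h_k^\dagger\mathbf W_j)+N_0\ge\frac{\lambda_k}{1-\rho_k},\quad 0\le\rho_k\le1,\ \mathbf W_k\succeq\mathbf 0\ \ \forall k,\qquad \sum_{k=1}^K\operatorname{tr}(\mathbf A_l\mathbf W_k)\le P_l\ \ \forall l,$$ over Hermitian $\mathbf W_k\in\mathbb C^{N_t\times N_t}$; points at which a denominator $\rho_k$ or $1-\rho_k$ that occurs in the constraints is zero are not feasible. If (P5) is feasible, it has an optimal solution. Every optimal solution $(\{\mathbf W_k\},\{\rho_k\})$ of (P5) satisfies $\operatorname{rank}(\mathbf W_k)=1$ for all $k$, so the relaxation is tight, and an optimal solution of (P2) is recovered by eigenvalue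 decomposition: each $\mathbf W_k$ has a positive eigenvalue, and whenever $\mathbf u_k$ is a unit eigenvector of $\mathbf W_k$ with eigenvalue $\mu_k>0$ and $\mathbf w_k=\sqrt{\mu_k}\,\mathbf u_k$ for all $k$, then $\mathbf W_k=\mathbf w_k\mathbf w_k^\dagger$ for all $k$, $(\{\mathbf w_k\},\{\rho_k\})$ is an optimal solution of (P2), and $\sum_k\|\mathbf w_k\|^2=\sum_k\operatorname{tr}\mathbf W_k$. -/

import Mathlib

open Matrix
open scoped ComplexOrder

/-- The data of a multiuser MISO SWIPT downlink with `Nt` transmit antennas, `K` single-antenna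
power-splitting receivers and `L` SAR constraints. -/
structure SwiptData (Nt K L : ℕ) where
  /-- channel vector of receiver `k` -/
  h : Fin K → Fin Nt → ℂ
  /-- antenna noise variance -/
  N0 : ℝ
  /-- circuit noise variance of receiver `k` -/
  NC : Fin K → ℝ
  /-- SINR target of receiver `k` -/
  gam : Fin K → ℝ
  /-- required input power of the energy harvester of receiver `k` -/
  lam : Fin K → ℝ
  /-- SAR matrices -/
  A : Fin L → Matrix (Fin Nt) (Fin Nt) ℂ
  /-- SAR limits -/
  P : Fin L → ℝ

namespace SwiptData

variable {Nt K L : ℕ} (D : SwiptData Nt K L)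

/-! ### The beamforming problem -/

/-- `|h_k† w|²`, the power received by receiver `k` from the beamformer `w`. -/
noncomputable def gain (k : Fin K) (w : Fin Nt → ℂ) : ℝ :=
  ‖star (D.h k) ⬝ᵥ w‖ ^ 2

/-- Total transmit power `∑ₖ ‖w_k‖²` (Euclidean norms). -/
noncomputable def beamPower (w : Fin K → Fin Nt → ℂ) : ℝ :=
  ∑ k, ∑ i, ‖w k i‖ ^ 2

/-- Feasibility of the beamformers `w` and the power splitting ratios `ρ`: SINR constraints,
energy harvesting constraints, power splitting ratios in `[0, 1]`, SAR constraints.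
The ratio `0` is excluded because the SINR contains the term `N_C / ρ_k`. -/
structure BeamFeasible (w : Fin K → Fin Nt → ℂ) (ρ : Fin K → ℝ) : Prop where
  rho_pos : ∀ k, 0 < ρ k
  rho_le_one : ∀ k, ρ k ≤ 1
  sinr : ∀ k, D.gam k ≤
    D.gain k (w k) / ((∑ j ∈ Finset.univ.erase k, D.gain k (w j)) + D.N0 + D.NC k / ρ k)
  harvest : ∀ k, D.lam k ≤ (1 - ρ k) * ((∑ j, D.gain k (w j)) + D.N0)
  sar : ∀ l, ∑ k, (star (w k) ⬝ᵥ (D.A l *ᵥ w k)).re ≤ D.P l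

/-- Global optimality for the beamforming problem: minimum power among all feasible points. -/
def BeamOptimal (w : Fin K → Fin Nt → ℂ) (ρ : Fin K → ℝ) : Prop :=
  D.BeamFeasible w ρ ∧ ∀ w' ρ', D.BeamFeasible w' ρ' → beamPower w ≤ beamPower w'

/-! ### The rank-relaxed semidefinite program -/

/-- `trace (h_k h_k† W)` (a real number when `W` is Hermitian). -/
noncomputable def sdpGain (k : Fin K) (W : Matrix (Fin Nt) (Fin Nt) ℂ) : ℝ :=
  ((vecMulVec (D.h k) (star (D.h k)) * W).trace).re

/-- Total transmit power `∑ₖ trace W_k`. -/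
noncomputable def sdpPower (W : Fin K → Matrix (Fin Nt) (Fin Nt) ℂ) : ℝ :=
  ∑ k, (W k).trace.re

/-- Feasibility for the rank-relaxed program. The ratios `0` and `1` are excluded because the
constraints contain the terms `N_C / ρ_k` and `λ_k / (1 - ρ_k)`. -/
structure SdpFeasible (W : Fin K → Matrix (Fin Nt) (Fin Nt) ℂ) (ρ : Fin K → ℝ) : Prop where
  psd : ∀ k, (W k).PosSemidef
  rho_pos : ∀ k, 0 < ρ k
  rho_lt_one : ∀ k, ρ k < 1
  sinr : ∀ k, D.gam k / (1 + D.gam k) ≤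
    D.sdpGain k (W k) / ((∑ j, D.sdpGain k (W j)) + D.N0 + D.NC k / ρ k)
  harvest : ∀ k, D.lam k / (1 - ρ k) ≤ (∑ j, D.sdpGain k (W j)) + D.N0
  sar : ∀ l, ∑ k, ((D.A l * W k).trace).re ≤ D.P l

/-- Global optimality for the rank-relaxed program. -/
def SdpOptimal (W : Fin K → Matrix (Fin Nt) (Fin Nt) ℂ) (ρ : Fin K → ℝ) : Prop :=
  D.SdpFeasible W ρ ∧ ∀ W' ρ', D.SdpFeasible W' ρ' → sdpPower W ≤ sdpPower W'

end SwiptData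

/-- `w` is read off from an eigenvalue decomposition of `W`: `w = √μ • u` with `u` a unit
eigenvector of `W` for a positive eigenvalue `μ`. -/
def IsEigenBeamformer {n : ℕ} (W : Matrix (Fin n) (Fin n) ℂ) (w : Fin n → ℂ) : Prop :=
  ∃ (μ : ℝ) (u : Fin n → ℂ), 0 < μ ∧ ∑ i, ‖u i‖ ^ 2 = 1 ∧
    W *ᵥ u = (μ : ℂ) • u ∧ w = (Real.sqrt μ : ℂ) • u

/-! The textbook route takes multipliers α_k, β_k, ν_l for the SINR, harvesting and SAR constraints.
The dual matrix of user k is then Q - α_k ρ_k c_k h_k h_k†, with c_k = `sinrCoef` and Q = I + ∑ (α_j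
ρ_j - β_j (1 - ρ_j)) h_j h_j† + ∑ ν_l A_l. It is positive semidefinite and annihilates W_k, so W_k
has rank at most one once Q is positive definite. The SINR target excludes W_k = 0.

Q is positive definite despite the negative terms. If x†Qx ≤ 0, semidefiniteness of every dual
matrix forces α_j ρ_j |h_j†x|² = 0 for all j. Stationarity in ρ_j bounds β_j by a multiple of α_j,
so the negative terms vanish too and x†Qx ≥ ‖x‖² > 0, a contradiction.

Multipliers at the optimum z need not exist, since no Slater point is assumed. A squared distance to
z is therefore added to the power, making z a strict minimizer, and the constraints are replaced by
a quadratic penalty (`exists_isLocalMinOn_penalized`). Local minimizers p near z carry explicit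
multipliers, possibly unbounded as p approaches z. The argument above survives because
`pos_of_dominated` uses only their ratios and an error that tends to 0. It yields an identity for p
that encodes rank at most one; this condition is closed, so it holds at z.

Tightness follows because w ↦ w w† embeds the beamforming problem in the relaxation with equal
power. -/

open Filter Topology

/-! ### Quadratic penalties and first-order conditions -/

theorem sq_max_zero_le (a b : ℝ) :
    max (a + b) 0 ^ 2 ≤ max a 0 ^ 2 + 2 * max a 0 * b + b ^ 2 := by
  rcases le_total a 0 with ha | ha <;> rcases le_total (a + b) 0 with hb | hb <;>
    simp only [max_eq_left, max_eq_right, ha, hb] <;> nlinarith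

/-- First order condition for a quadratic objective with quadratic penalties. -/
theorem nonneg_of_penalized_min {ι : Type*} [Fintype ι] (n p q : ℝ) (hn : 0 ≤ n) (a b : ι → ℝ)
    (h : ∀ᶠ t : ℝ in 𝓝[>] 0, n * ∑ i, max (a i) 0 ^ 2 ≤
      t * p + t ^ 2 * q + n * ∑ i, max (a i + t * b i) 0 ^ 2) :
    0 ≤ p + ∑ i, 2 * n * max (a i) 0 * b i := by
  set C := q + n * ∑ i, b i ^ 2
  have h2 : ∀ᶠ t : ℝ in 𝓝[>] 0, 0 ≤ (p + ∑ i, 2 * n * max (a i) 0 * b i) + t * C := by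
    filter_upwards [h, self_mem_nhdsWithin] with t ht ht0
    have ht0 : 0 < t := ht0
    have h3 : ∑ i, max (a i + t * b i) 0 ^ 2 ≤
        ∑ i, (max (a i) 0 ^ 2 + 2 * max (a i) 0 * (t * b i) + (t * b i) ^ 2) :=
      Finset.sum_le_sum fun i _ => sq_max_zero_le _ _
    have h4 : n * ∑ i, (max (a i) 0 ^ 2 + 2 * max (a i) 0 * (t * b i) + (t * b i) ^ 2) =
        n * ∑ i, max (a i) 0 ^ 2 + t * ∑ i, 2 * n * max (a i) 0 * b i
          + t ^ 2 * (n * ∑ i, b i ^ 2) := by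
      simp only [Finset.mul_sum, ← Finset.sum_add_distrib]
      exact Finset.sum_congr rfl fun i _ => by ring
    have h5 := mul_le_mul_of_nonneg_left h3 hn
    have h6 : 0 ≤ t * ((p + ∑ i, 2 * n * max (a i) 0 * b i) + t * C) := by
      simp only [C]; linarith
    exact nonneg_of_mul_nonneg_right h6 ht0
  have h7 : Tendsto (fun t : ℝ => (p + ∑ i, 2 * n * max (a i) 0 * b i) + t * C) (𝓝[>] 0)
      (𝓝 ((p + ∑ i, 2 * n * max (a i) 0 * b i) + 0 * C)) := by
    apply Tendsto.mono_left _ nhdsWithin_le_nhds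
    exact (Continuous.tendsto (by fun_prop) 0)
  simpa using ge_of_tendsto h7 h2

/-- A strict constrained minimizer is a limit of local minimizers of the penalized problems. -/
theorem exists_isLocalMinOn_penalized {X : Type*} [TopologicalSpace X] [T2Space X]
    [LocallyCompactSpace X] {S V : Set X} (hS : IsClosed S) {F G : X → ℝ} (hF : Continuous F)
    (hG : Continuous G) (hG0 : ∀ x, 0 ≤ G x) {z : X} (hz : z ∈ S) (hGz : G z = 0)
    (hmin : ∀ x ∈ S, G x = 0 → F x ≤ F z → x = z) (hV : V ∈ 𝓝 z) :
    ∃ n : ℝ, 0 ≤ n ∧ ∃ x ∈ V ∩ S, IsLocalMinOn (fun y => F y + n * G y) S x := by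
  obtain ⟨K, hK, hKz⟩ := exists_compact_mem_nhds z
  set U := interior (K ∩ V) with hU
  have hUz : z ∈ U := mem_interior_iff_mem_nhds.2 (inter_mem hKz hV)
  have hUK : U ⊆ K ∩ V := interior_subset
  -- Otherwise the nested compact sets `T n` have a common point. Letting n grow gives G = 0 there,
  -- so strict minimality makes it z, which lies in U.
  obtain ⟨n, hn⟩ : ∃ n : ℕ, ∀ x ∈ (K ∩ S) \ U, F z < F x + n * G x := by
    by_contra! hcon
    set T : ℕ → Set X := fun n => ((K ∩ S) \ U) ∩ {x | F x + n * G x ≤ F z}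
    have hc : IsCompact ((K ∩ S) \ U) := (hK.inter_right hS).diff isOpen_interior
    have hcl : ∀ n : ℕ, IsClosed {x | F x + n * G x ≤ F z} := fun n =>
      isClosed_le (by fun_prop) continuous_const
    obtain ⟨x, hx⟩ := IsCompact.nonempty_iInter_of_sequence_nonempty_isCompact_isClosed T
      (fun i x hx => ⟨hx.1, by
        have h1 : F x + ((i + 1 : ℕ) : ℝ) * G x ≤ F z := hx.2
        have h2 := hG0 x
        push_cast at h1
        show F x + i * G x ≤ F z
        nlinarith⟩)
      (fun i => by obtain ⟨x, hx, hx'⟩ := hcon i; exact ⟨x, hx, hx'⟩)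
      (hc.inter_right (hcl 0)) (fun i => hc.isClosed.inter (hcl i))
    rw [Set.mem_iInter] at hx
    have hxG : G x = 0 := by
      by_contra hne
      have hpos : 0 < G x := lt_of_le_of_ne (hG0 x) (Ne.symm hne)
      obtain ⟨m, hm⟩ := exists_nat_gt ((F z - F x) / G x)
      have h1 : F x + m * G x ≤ F z := (hx m).2
      rw [div_lt_iff₀ hpos] at hm
      linarith
    have h0 : F x + ((0 : ℕ) : ℝ) * G x ≤ F z := (hx 0).2
    have := hmin x (hx 0).1.1.2 hxG (by simpa using h0)
    exact (hx 0).1.2 (this ▸ hUz)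
  obtain ⟨x, hx, hxm⟩ := (hK.inter_right hS).exists_isMinOn (f := fun y => F y + n * G y)
    ⟨z, (hUK hUz).1, hz⟩ (by fun_prop)
  -- The compact minimizer cannot lie outside U, where the objective exceeds its value at z; being
  -- interior, it is a local minimizer on S.
  have hxU : x ∈ U := by
    by_contra hxU
    have h1 := hn x ⟨hx, hxU⟩
    have h2 : F x + n * G x ≤ F z + n * G z := hxm ⟨(hUK hUz).1, hz⟩
    rw [hGz] at h2
    linarith
  refine ⟨n, n.cast_nonneg, x, ⟨(hUK hxU).2, hx.2⟩, ?_⟩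
  have : ∀ᶠ y in 𝓝[S] x, y ∈ U ∧ y ∈ S :=
    (show ∀ᶠ y in 𝓝[S] x, y ∈ U from
      mem_nhdsWithin_of_mem_nhds (isOpen_interior.mem_nhds hxU)).and self_mem_nhdsWithin
  filter_upwards [this] with y hy
  exact hxm ⟨(hUK hy.1).1, hy.2⟩

/-! ### Positive semidefinite matrices and quadratic forms -/

namespace Matrix

variable {n : Type*} [Fintype n]

theorem re_trace_mul_vecMulVec_star (M : Matrix n n ℂ) (v : n → ℂ) :
    (M * vecMulVec v (star v)).trace.re = (star v ⬝ᵥ (M *ᵥ v)).re := by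
  rw [mul_vecMulVec, trace_vecMulVec, dotProduct_comm]

theorem re_star_dotProduct_self (v : n → ℂ) : (star v ⬝ᵥ v).re = ∑ i, ‖v i‖ ^ 2 := by
  simp only [dotProduct, Complex.re_sum, Pi.star_apply]
  refine Finset.sum_congr rfl fun i _ => ?_
  rw [RCLike.star_def, ← Complex.normSq_eq_conj_mul_self, Complex.ofReal_re,
    Complex.normSq_eq_norm_sq]

theorem isClosed_setOf_posSemidef : IsClosed {M : Matrix n n ℂ | M.PosSemidef} := by
  have : {M : Matrix n n ℂ | M.PosSemidef} =
      {M | Mᴴ = M} ∩ ⋂ x : n → ℂ, {M | 0 ≤ star x ⬝ᵥ (M *ᵥ x)} := by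
    ext M
    simp [posSemidef_iff_dotProduct_mulVec, IsHermitian]
  rw [this]
  refine (isClosed_eq (continuous_id.matrix_conjTranspose) continuous_id).inter
    (isClosed_iInter fun x => ?_)
  have hc : Continuous fun M : Matrix n n ℂ => star x ⬝ᵥ (M *ᵥ x) :=
    continuous_const.dotProduct (continuous_id.matrix_mulVec continuous_const)
  exact (isClosed_le continuous_const (Complex.continuous_re.comp hc)).inter
    (isClosed_eq continuous_const (Complex.continuous_im.comp hc))

theorem PosSemidef.norm_apply_le_trace {M : Matrix n n ℂ} (hM : M.PosSemidef) (i j : n) :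
    ‖M i j‖ ≤ M.trace.re := by
  obtain ⟨m, v, rfl⟩ := posSemidef_iff_eq_sum_vecMulVec.1 hM
  rw [trace_sum, sum_apply, Complex.re_sum]
  simp only [trace_vecMulVec, vecMulVec_apply]
  refine (norm_sum_le _ _).trans (Finset.sum_le_sum fun k _ => ?_)
  rw [dotProduct_comm, re_star_dotProduct_self, Pi.star_apply, norm_mul, norm_star]
  have hi := Finset.single_le_sum (f := fun i => ‖v k i‖ ^ 2) (fun _ _ => by positivity)
    (Finset.mem_univ i)
  have hj := Finset.single_le_sum (f := fun i => ‖v k i‖ ^ 2) (fun _ _ => by positivity)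
    (Finset.mem_univ j)
  nlinarith [sq_nonneg (‖v k i‖ - ‖v k j‖)]

/-- Complementary slackness: for W = ∑ v v†, the trace is a sum of nonnegative terms v†Zv, so each
vanishes and Zv = 0. -/
theorem PosSemidef.mul_eq_zero_of_re_trace_nonpos {Z W : Matrix n n ℂ} (hZ : Z.PosSemidef)
    (hW : W.PosSemidef) (h : (Z * W).trace.re ≤ 0) : Z * W = 0 := by
  obtain ⟨m, v, rfl⟩ := posSemidef_iff_eq_sum_vecMulVec.1 hW
  simp only [Finset.mul_sum, trace_sum, Complex.re_sum, re_trace_mul_vecMulVec_star] at h ⊢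
  have h0 : ∀ i ∈ Finset.univ, 0 ≤ (star (v i) ⬝ᵥ (Z *ᵥ v i)).re := fun i _ =>
    hZ.re_dotProduct_nonneg (v i)
  have h1 := (Finset.sum_eq_zero_iff_of_nonneg h0).1 (le_antisymm h (Finset.sum_nonneg h0))
  refine Finset.sum_eq_zero fun i hi => ?_
  have h2 : star (v i) ⬝ᵥ (Z *ᵥ v i) = 0 := by
    have := hZ.dotProduct_mulVec_nonneg (v i)
    exact Complex.ext (h1 i hi) (Complex.le_def.1 this).2.symm
  rw [mul_vecMulVec, (hZ.dotProduct_mulVec_zero_iff _).1 h2, zero_vecMulVec]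

theorem posSemidef_of_re_nonneg {Z : Matrix n n ℂ} (hZ : Z.IsHermitian)
    (h : ∀ x, 0 ≤ (star x ⬝ᵥ (Z *ᵥ x)).re) : Z.PosSemidef := by
  refine PosSemidef.of_dotProduct_mulVec_nonneg hZ fun x => Complex.le_def.2 ⟨h x, ?_⟩
  exact (hZ.im_star_dotProduct_mulVec_self x).symm

theorem norm_star_dotProduct_sq_le (h x : n → ℂ) :
    ‖star h ⬝ᵥ x‖ ^ 2 ≤ (∑ i, ‖h i‖ ^ 2) * ∑ i, ‖x i‖ ^ 2 := by
  refine (pow_le_pow_left₀ (norm_nonneg _) (norm_sum_le _ _) 2).trans ?_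
  simp only [norm_mul, Pi.star_apply, norm_star]
  exact Finset.sum_mul_sq_le_sq_mul_sq _ _ _

theorem abs_re_star_dotProduct_mulVec_le (E : Matrix n n ℂ) (x : n → ℂ) :
    |(star x ⬝ᵥ (E *ᵥ x)).re| ≤ (∑ i, ∑ j, ‖E i j‖) * ∑ i, ‖x i‖ ^ 2 := by
  refine (Complex.abs_re_le_norm _).trans ?_
  simp only [dotProduct, mulVec]
  refine (norm_sum_le _ _).trans ?_
  rw [Finset.sum_mul]
  refine Finset.sum_le_sum fun i _ => ?_
  rw [Finset.mul_sum, Finset.sum_mul]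
  refine (norm_sum_le _ _).trans ?_
  refine Finset.sum_le_sum fun j _ => ?_
  rw [Pi.star_apply, norm_mul, norm_mul, norm_star]
  have hi := Finset.single_le_sum (f := fun i => ‖x i‖ ^ 2) (fun _ _ => by positivity)
    (Finset.mem_univ i)
  have hj := Finset.single_le_sum (f := fun i => ‖x i‖ ^ 2) (fun _ _ => by positivity)
    (Finset.mem_univ j)
  have : ‖x i‖ * ‖x j‖ ≤ ∑ i, ‖x i‖ ^ 2 := by nlinarith [sq_nonneg (‖x i‖ - ‖x j‖)]
  calc _ = ‖E i j‖ * (‖x i‖ * ‖x j‖) := by ring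
    _ ≤ _ := by gcongr

end Matrix

/-! ### Finite sums and the domination inequality -/

theorem Fintype.sum_apply_update {ι β : Type*} [Fintype ι] [DecidableEq ι] (φ : ι → β → ℝ)
    (W : ι → β) (k : ι) (M : β) :
    ∑ j, φ j (Function.update W k M j) = ∑ j, φ j (W j) + (φ k M - φ k (W k)) := by
  rw [← Finset.add_sum_erase _ _ (Finset.mem_univ k),
    ← Finset.add_sum_erase _ (fun j => φ j (W j)) (Finset.mem_univ k)]
  rw [Finset.sum_congr rfl fun j hj => by
    rw [Function.update_of_ne (Finset.ne_of_mem_erase hj)]]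
  simp only [Function.update_self, Finset.mem_univ, Finset.sum_erase_eq_sub]
  ring

/-- If the quadratic forms `X + e k + ∑ j, (a j - b j) y j + s` dominate `a k c k y k` for
all `k`, and the negative coefficients `b` are controlled by `a`, then they are positive. -/
theorem pos_of_dominated {ι : Type*} [Fintype ι] (X s : ℝ) (e η a b c y H κ θ : ι → ℝ)
    (hX : 0 < X) (hs : 0 ≤ s) (he : ∀ j, |e j| ≤ η j * X) (hη : ∀ j, 0 ≤ η j)
    (hy : ∀ j, 0 ≤ y j) (hyH : ∀ j, y j ≤ H j * X) (ha : ∀ j, 0 ≤ a j)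
    (hb : ∀ j, b j ≤ κ j * a j + θ j) (hκ : ∀ j, 0 ≤ κ j) (hθ : ∀ j, 0 ≤ θ j)
    (hc : ∀ j, 1 ≤ c j)
    (hZ : ∀ k, a k * c k * y k ≤ X + e k + ∑ j, (a j - b j) * y j + s)
    (hsmall : ∑ j, η j + ∑ j, (2 * κ j * ∑ i, η i + θ j * H j) < 1) (k : ι) :
    0 < X + e k + ∑ j, (a j - b j) * y j + s := by
  by_contra! hcon
  have hηle : ∀ j, η j ≤ ∑ i, η i := fun j =>
    Finset.single_le_sum (fun i _ => hη i) (Finset.mem_univ j)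
  -- The forms for j and k differ only by e j - e k. The one for k is assumed nonpositive, so the
  -- one for j, which dominates a j * y j, is at most (η j + η k) X.
  have hay : ∀ j, a j * y j ≤ 2 * (∑ i, η i) * X := by
    intro j
    have h1 := hZ j
    have h2 := abs_le.1 (he j)
    have h3 := abs_le.1 (he k)
    have h4 := mul_le_mul_of_nonneg_right (hηle j) hX.le
    have h5 := mul_le_mul_of_nonneg_right (hηle k) hX.le
    have h6 : a j * y j ≤ a j * c j * y j := by
      have := mul_le_mul_of_nonneg_left (hc j) (mul_nonneg (ha j) (hy j))
      linarith
    linarith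
  have hsum : -(∑ j, (2 * κ j * ∑ i, η i + θ j * H j)) * X ≤ ∑ j, (a j - b j) * y j := by
    rw [neg_mul, Finset.sum_mul, ← Finset.sum_neg_distrib]
    refine Finset.sum_le_sum fun j _ => ?_
    have h1 := mul_le_mul_of_nonneg_right (hb j) (hy j)
    have h2 := mul_le_mul_of_nonneg_left (hay j) (hκ j)
    have h3 := mul_le_mul_of_nonneg_left (hyH j) (hθ j)
    have h4 := mul_nonneg (ha j) (hy j)
    nlinarith
  have h3 := (abs_le.1 (he k)).1
  have h5 := mul_le_mul_of_nonneg_right (hηle k) hX.le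
  nlinarith

/-! ### The relaxed program in closed form, and existence of an optimum -/

namespace SwiptData

variable {Nt K L : ℕ} (D : SwiptData Nt K L)

theorem sdpGain_eq (k : Fin K) (W : Matrix (Fin Nt) (Fin Nt) ℂ) :
    D.sdpGain k W = (star (D.h k) ⬝ᵥ (W *ᵥ D.h k)).re := by
  rw [sdpGain, trace_mul_comm, re_trace_mul_vecMulVec_star]

theorem sdpGain_nonneg (k : Fin K) {W : Matrix (Fin Nt) (Fin Nt) ℂ} (hW : W.PosSemidef) :
    0 ≤ D.sdpGain k W := by
  rw [sdpGain_eq]; exact hW.re_dotProduct_nonneg _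

theorem sdpGain_vecMulVec (k : Fin K) (w : Fin Nt → ℂ) :
    D.sdpGain k (vecMulVec w (star w)) = D.gain k w := by
  rw [sdpGain, vecMulVec_mul_vecMulVec, trace_vecMulVec, dotProduct_smul, smul_eq_mul, gain,
    dotProduct_comm (D.h k), star_dotProduct w, RCLike.star_def, Complex.mul_conj,
    Complex.ofReal_re, Complex.normSq_eq_norm_sq]

theorem continuous_sdpGain (k : Fin K) : Continuous (D.sdpGain k) := by
  unfold sdpGain
  exact Complex.continuous_re.comp (continuous_const.matrix_mul continuous_id).matrix_trace

theorem sdpGain_add_smul (k : Fin K) (W M : Matrix (Fin Nt) (Fin Nt) ℂ) (t : ℝ) :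
    D.sdpGain k (W + (t : ℂ) • M) = D.sdpGain k W + t * D.sdpGain k M := by
  simp [sdpGain, mul_add, trace_add, trace_smul]

/-- Factor `(1 + γ) / γ` of the useful power in the relaxed SINR constraint. -/
noncomputable def sinrCoef (k : Fin K) : ℝ := (1 + D.gam k) / D.gam k

/-- Constraint functions of the relaxed program, cleared of denominators; they are
nonpositive at feasible points. -/
noncomputable def viol (W : Fin K → Matrix (Fin Nt) (Fin Nt) ℂ) (ρ : Fin K → ℝ) :
    Fin K ⊕ Fin K ⊕ Fin L → ℝ :=
  Sum.elim
    (fun k => D.NC k - ρ k * (D.sinrCoef k * D.sdpGain k (W k) - ∑ j, D.sdpGain k (W j) - D.N0))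
    (Sum.elim (fun k => D.lam k - (1 - ρ k) * (∑ j, D.sdpGain k (W j) + D.N0))
      (fun l => ∑ k, ((D.A l * W k).trace).re - D.P l))

/-- The cone of positive semidefinite matrices and ratios in `[0, 1]`. -/
def baseSet (Nt K : ℕ) : Set ((Fin K → Matrix (Fin Nt) (Fin Nt) ℂ) × (Fin K → ℝ)) :=
  {p | (∀ k, (p.1 k).PosSemidef) ∧ ∀ k, p.2 k ∈ Set.Icc (0 : ℝ) 1}

theorem isClosed_baseSet : IsClosed (baseSet Nt K) := by
  have : baseSet Nt K = (⋂ k, {p | (p.1 k).PosSemidef}) ∩ ⋂ k, {p | p.2 k ∈ Set.Icc (0 : ℝ) 1} := by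
    ext p; simp [baseSet]
  rw [this]
  refine (isClosed_iInter fun k => ?_).inter (isClosed_iInter fun k => ?_)
  · exact isClosed_setOf_posSemidef.preimage
      (f := fun p : (Fin K → Matrix (Fin Nt) (Fin Nt) ℂ) × (Fin K → ℝ) => p.1 k) (by fun_prop)
  · exact isClosed_Icc.preimage
      (f := fun p : (Fin K → Matrix (Fin Nt) (Fin Nt) ℂ) × (Fin K → ℝ) => p.2 k) (by fun_prop)

theorem continuous_viol (i : Fin K ⊕ Fin K ⊕ Fin L) :
    Continuous fun p : (Fin K → Matrix (Fin Nt) (Fin Nt) ℂ) × (Fin K → ℝ) =>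
      D.viol p.1 p.2 i := by
  have hg : ∀ k j, Continuous fun p : (Fin K → Matrix (Fin Nt) (Fin Nt) ℂ) × (Fin K → ℝ) =>
      D.sdpGain k (p.1 j) := fun k j => (D.continuous_sdpGain k).comp (by fun_prop)
  have hA : ∀ l k, Continuous fun p : (Fin K → Matrix (Fin Nt) (Fin Nt) ℂ) × (Fin K → ℝ) =>
      ((D.A l * p.1 k).trace).re := fun l k => Complex.continuous_re.comp
        (Continuous.matrix_trace (continuous_const.matrix_mul (by fun_prop)))
  rcases i with k | k | l <;> simp only [viol, Sum.elim_inl, Sum.elim_inr] <;> fun_prop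

theorem continuous_sdpPower :
    Continuous (sdpPower : (Fin K → Matrix (Fin Nt) (Fin Nt) ℂ) → ℝ) := by
  unfold sdpPower
  exact continuous_finsetSum _ fun k _ => Complex.continuous_re.comp
    (Continuous.matrix_trace (by fun_prop))

variable {D}

/-- Clearing denominators loses nothing: at ρ = 0 or ρ = 1 the polynomial constraints would give N_C
≤ 0 or λ ≤ 0. Hence the feasible set is closed. -/
theorem sdpFeasible_iff (hN0 : 0 < D.N0) (hNC : ∀ k, 0 < D.NC k) (hgam : ∀ k, 0 < D.gam k)
    (hlam : ∀ k, 0 < D.lam k) (W : Fin K → Matrix (Fin Nt) (Fin Nt) ℂ) (ρ : Fin K → ℝ) :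
    D.SdpFeasible W ρ ↔ (W, ρ) ∈ baseSet Nt K ∧ ∀ i, D.viol W ρ i ≤ 0 := by
  have key : (∀ k, (W k).PosSemidef) → ∀ k, 0 < ρ k → (D.gam k / (1 + D.gam k) ≤
      D.sdpGain k (W k) / ((∑ j, D.sdpGain k (W j)) + D.N0 + D.NC k / ρ k) ↔
      D.viol W ρ (Sum.inl k) ≤ 0) := by
    intro hW k hρ
    have hg := hgam k
    have hS : 0 ≤ ∑ j, D.sdpGain k (W j) :=
      Finset.sum_nonneg fun j _ => D.sdpGain_nonneg k (hW j)
    have hden : 0 < (∑ j, D.sdpGain k (W j)) + D.N0 + D.NC k / ρ k := by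
      have := div_pos (hNC k) hρ
      linarith
    rw [div_le_div_iff₀ (by linarith) hden]
    have e1 : D.viol W ρ (Sum.inl k) = (D.gam k * ((∑ j, D.sdpGain k (W j)) + D.N0 + D.NC k / ρ k)
        - D.sdpGain k (W k) * (1 + D.gam k)) * (ρ k / D.gam k) := by
      simp only [viol, Sum.elim_inl, sinrCoef]
      field_simp
      ring
    rw [e1]
    have hpos := div_pos hρ hg
    constructor
    · intro h; exact mul_nonpos_of_nonpos_of_nonneg (by linarith) hpos.le
    · intro h
      by_contra! hlt
      have := mul_pos (sub_pos.2 hlt) hpos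
      linarith
  constructor
  · intro h
    refine ⟨⟨h.psd, fun k => ⟨(h.rho_pos k).le, (h.rho_lt_one k).le⟩⟩, ?_⟩
    rintro (k | k | l)
    · exact (key h.psd k (h.rho_pos k)).1 (h.sinr k)
    · have h1 := h.harvest k
      rw [div_le_iff₀ (sub_pos.2 (h.rho_lt_one k))] at h1
      simp only [viol, Sum.elim_inl, Sum.elim_inr]
      linarith
    · have := h.sar l
      simp only [viol, Sum.elim_inr]
      linarith
  · rintro ⟨⟨hW, hρ⟩, hv⟩
    have h0 : ∀ k, 0 < ρ k := by
      intro k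
      refine lt_of_le_of_ne (hρ k).1 fun he => ?_
      have := hv (Sum.inl k)
      simp only [viol, Sum.elim_inl, ← he] at this
      linarith [hNC k]
    have h1 : ∀ k, ρ k < 1 := by
      intro k
      refine lt_of_le_of_ne (hρ k).2 fun he => ?_
      have := hv (Sum.inr (Sum.inl k))
      simp only [viol, Sum.elim_inl, Sum.elim_inr, he] at this
      linarith [hlam k]
    refine ⟨hW, h0, h1, fun k => (key hW k (h0 k)).2 (hv _), fun k => ?_, fun l => ?_⟩
    · rw [div_le_iff₀ (sub_pos.2 (h1 k))]
      have := hv (Sum.inr (Sum.inl k))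
      simp only [viol, Sum.elim_inl, Sum.elim_inr] at this
      linarith
    · have := hv (Sum.inr (Sum.inr l))
      simp only [viol, Sum.elim_inr] at this
      linarith

theorem exists_sdpOptimal (hN0 : 0 < D.N0) (hNC : ∀ k, 0 < D.NC k) (hgam : ∀ k, 0 < D.gam k)
    (hlam : ∀ k, 0 < D.lam k) (h : ∃ W ρ, D.SdpFeasible W ρ) : ∃ W ρ, D.SdpOptimal W ρ := by
  obtain ⟨W₀, ρ₀, h₀⟩ := h
  set S : Set ((Fin K → Matrix (Fin Nt) (Fin Nt) ℂ) × (Fin K → ℝ)) :=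
    {p | D.SdpFeasible p.1 p.2 ∧ sdpPower p.1 ≤ sdpPower W₀}
  have hcl : IsClosed S := by
    have : S = (baseSet Nt K ∩ ⋂ i, {p | D.viol p.1 p.2 i ≤ 0}) ∩
        {p | sdpPower p.1 ≤ sdpPower W₀} := by
      ext p
      simp only [S, Set.mem_ofPred_eq, sdpFeasible_iff hN0 hNC hgam hlam, Set.mem_inter_iff,
        Set.mem_iInter]
    rw [this]
    exact (isClosed_baseSet.inter (isClosed_iInter fun i =>
      isClosed_le (D.continuous_viol i) continuous_const)).inter
      (isClosed_le (continuous_sdpPower.comp continuous_fst) continuous_const)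
  have hbox : IsCompact ((Set.univ.pi fun _ : Fin K => Set.univ.pi fun _ : Fin Nt =>
      Set.univ.pi fun _ : Fin Nt => Metric.closedBall (0 : ℂ) (sdpPower W₀)) :
      Set (Fin K → Fin Nt → Fin Nt → ℂ)) :=
    isCompact_univ_pi fun _ => isCompact_univ_pi fun _ => isCompact_univ_pi fun _ =>
      isCompact_closedBall _ _
  have hbox2 : IsCompact ((Set.univ.pi fun _ : Fin K => Set.Icc (0 : ℝ) 1)) :=
    isCompact_univ_pi fun _ => isCompact_Icc
  -- The trace of a positive semidefinite matrix bounds its entries, so a sublevel set of the power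
  -- is bounded.
  have hS : IsCompact S := by
    refine IsCompact.of_isClosed_subset (hbox.prod hbox2) hcl ?_
    rintro ⟨W, ρ⟩ ⟨hf, hp⟩
    refine ⟨fun k _ i _ j _ => ?_, fun k _ => ⟨(hf.rho_pos k).le, (hf.rho_lt_one k).le⟩⟩
    rw [mem_closedBall_zero_iff]
    refine ((hf.psd k).norm_apply_le_trace i j).trans (le_trans ?_ hp)
    exact Finset.single_le_sum (f := fun k => (W k).trace.re)
      (fun k _ => (Complex.le_def.1 (hf.psd k).trace_nonneg).1) (Finset.mem_univ k)
  obtain ⟨p, hp, hmin⟩ := hS.exists_isMinOn ⟨(W₀, ρ₀), h₀, le_rfl⟩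
    (continuous_sdpPower.comp continuous_fst).continuousOn
  refine ⟨p.1, p.2, hp.1, fun W' ρ' h' => ?_⟩
  rcases le_total (sdpPower W') (sdpPower W₀) with hle | hle
  · exact hmin (show (W', ρ') ∈ S from ⟨h', hle⟩)
  · exact hp.2.trans hle

end SwiptData

/-! ### The penalized objective and its one-sided derivatives -/

theorem Matrix.sum_norm_sq_add_smul {n : Type*} [Fintype n] (E M : Matrix n n ℂ) (t : ℝ) :
    ∑ i, ∑ j, ‖(E + (t : ℂ) • M) i j‖ ^ 2 = ∑ i, ∑ j, ‖E i j‖ ^ 2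
      + t * (2 * (Eᴴ * M).trace.re) + t ^ 2 * ∑ i, ∑ j, ‖M i j‖ ^ 2 := by
  have h1 : (Eᴴ * M).trace.re = ∑ i, ∑ j, (star (E i j) * M i j).re := by
    simp only [trace, diag, mul_apply, conjTranspose_apply, Complex.re_sum]
    exact Finset.sum_comm
  rw [h1]
  simp only [Finset.mul_sum, ← Finset.sum_add_distrib]
  refine Finset.sum_congr rfl fun i _ => Finset.sum_congr rfl fun j _ => ?_
  simp only [← Complex.normSq_eq_norm_sq, Complex.normSq_apply, add_apply, smul_apply, smul_eq_mul,
    Complex.add_re, Complex.add_im, Complex.mul_re, Complex.mul_im, Complex.ofReal_re,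
    Complex.ofReal_im, RCLike.star_def, Complex.conj_re, Complex.conj_im]
  ring

namespace SwiptData

variable {Nt K L : ℕ} (D : SwiptData Nt K L)

/-- Transmit power plus the squared distance to a reference point. -/
noncomputable def proxObjective (z p : (Fin K → Matrix (Fin Nt) (Fin Nt) ℂ) × (Fin K → ℝ)) : ℝ :=
  sdpPower p.1 + ∑ k, ∑ i, ∑ j, ‖(p.1 k - z.1 k) i j‖ ^ 2 + ∑ k, (p.2 k - z.2 k) ^ 2

/-- Sum of the squared constraint violations. -/
noncomputable def penalty (p : (Fin K → Matrix (Fin Nt) (Fin Nt) ℂ) × (Fin K → ℝ)) : ℝ :=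
  ∑ i, max (D.viol p.1 p.2 i) 0 ^ 2

/-- Lagrange multipliers produced by the penalty with weight `n`. -/
noncomputable def multiplier (n : ℝ) (p : (Fin K → Matrix (Fin Nt) (Fin Nt) ℂ) × (Fin K → ℝ))
    (i : Fin K ⊕ Fin K ⊕ Fin L) : ℝ :=
  2 * n * max (D.viol p.1 p.2 i) 0

theorem multiplier_nonneg {n : ℝ} (hn : 0 ≤ n)
    (p : (Fin K → Matrix (Fin Nt) (Fin Nt) ℂ) × (Fin K → ℝ)) (i : Fin K ⊕ Fin K ⊕ Fin L) :
    0 ≤ D.multiplier n p i := by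
  unfold multiplier; positivity

theorem sdpPower_update (W : Fin K → Matrix (Fin Nt) (Fin Nt) ℂ) (k : Fin K)
    (M : Matrix (Fin Nt) (Fin Nt) ℂ) (t : ℝ) :
    sdpPower (Function.update W k (W k + (t : ℂ) • M)) = sdpPower W + t * M.trace.re := by
  rw [sdpPower, Fintype.sum_apply_update (fun _ (V : Matrix (Fin Nt) (Fin Nt) ℂ) => V.trace.re)]
  simp [sdpPower, trace_add, trace_smul]

theorem sum_sdpGain_update (W : Fin K → Matrix (Fin Nt) (Fin Nt) ℂ) (i k : Fin K)
    (M : Matrix (Fin Nt) (Fin Nt) ℂ) (t : ℝ) :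
    ∑ j, D.sdpGain i (Function.update W k (W k + (t : ℂ) • M) j) =
      ∑ j, D.sdpGain i (W j) + t * D.sdpGain i M := by
  rw [Fintype.sum_apply_update (fun _ V => D.sdpGain i V), sdpGain_add_smul]
  ring

/-- Derivative of the constraint functions when `M` is added to the matrix of user `k`. -/
noncomputable def violDeriv (ρ : Fin K → ℝ) (k : Fin K) (M : Matrix (Fin Nt) (Fin Nt) ℂ) :
    Fin K ⊕ Fin K ⊕ Fin L → ℝ :=
  Sum.elim (fun j => ρ j * D.sdpGain j M - if j = k then ρ k * D.sinrCoef k * D.sdpGain k M else 0)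
    (Sum.elim (fun j => -((1 - ρ j) * D.sdpGain j M)) (fun l => ((D.A l * M).trace).re))

theorem viol_update (W : Fin K → Matrix (Fin Nt) (Fin Nt) ℂ) (ρ : Fin K → ℝ) (k : Fin K)
    (M : Matrix (Fin Nt) (Fin Nt) ℂ) (t : ℝ) (i : Fin K ⊕ Fin K ⊕ Fin L) :
    D.viol (Function.update W k (W k + (t : ℂ) • M)) ρ i =
      D.viol W ρ i + t * D.violDeriv ρ k M i := by
  rcases i with j | j | l
  · simp only [viol, violDeriv, Sum.elim_inl, sum_sdpGain_update]
    by_cases hjk : j = k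
    · subst hjk
      simp only [Function.update_self, sdpGain_add_smul, if_true]
      ring
    · rw [Function.update_of_ne hjk, if_neg hjk]
      ring
  · simp only [viol, violDeriv, Sum.elim_inl, Sum.elim_inr, sum_sdpGain_update]
    ring
  · simp only [viol, violDeriv, Sum.elim_inr]
    rw [Fintype.sum_apply_update (fun _ (V : Matrix (Fin Nt) (Fin Nt) ℂ) => ((D.A l * V).trace).re)]
    simp only [mul_add, Matrix.mul_smul, trace_add, trace_smul, smul_eq_mul, Complex.add_re,
      Complex.re_ofReal_mul]
    ring

/-- The part of the Lagrangian gradient common to the proximal term and all quadratic terms,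
without the useful power of user `k`. -/
noncomputable def gradBase (n : ℝ) (z p : (Fin K → Matrix (Fin Nt) (Fin Nt) ℂ) × (Fin K → ℝ))
    (k : Fin K) : Matrix (Fin Nt) (Fin Nt) ℂ :=
  1 + (2 : ℂ) • (p.1 k - z.1 k)
    + ∑ j, ((D.multiplier n p (Sum.inl j) * p.2 j
        - D.multiplier n p (Sum.inr (Sum.inl j)) * (1 - p.2 j) : ℝ) : ℂ) •
        vecMulVec (D.h j) (star (D.h j))
    + ∑ l, ((D.multiplier n p (Sum.inr (Sum.inr l)) : ℝ) : ℂ) • D.A l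

/-- Gradient of the penalized objective with respect to the matrix of user `k`. -/
noncomputable def grad (n : ℝ) (z p : (Fin K → Matrix (Fin Nt) (Fin Nt) ℂ) × (Fin K → ℝ))
    (k : Fin K) : Matrix (Fin Nt) (Fin Nt) ℂ :=
  D.gradBase n z p k - ((D.multiplier n p (Sum.inl k) * p.2 k * D.sinrCoef k : ℝ) : ℂ) •
    vecMulVec (D.h k) (star (D.h k))

variable {D}

theorem re_trace_grad_mul {n : ℝ} {z p : (Fin K → Matrix (Fin Nt) (Fin Nt) ℂ) × (Fin K → ℝ)}
    {k : Fin K} (hp : (p.1 k).IsHermitian) (hz : (z.1 k).IsHermitian)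
    (M : Matrix (Fin Nt) (Fin Nt) ℂ) :
    (D.grad n z p k * M).trace.re = M.trace.re + 2 * ((p.1 k - z.1 k)ᴴ * M).trace.re
      + ∑ i, D.multiplier n p i * D.violDeriv p.2 k M i := by
  have hE : (p.1 k - z.1 k)ᴴ = p.1 k - z.1 k := hp.sub hz
  rw [hE]
  simp only [grad, gradBase, sub_mul, add_mul, Finset.sum_mul, one_mul, Matrix.smul_mul, trace_add,
    trace_sub, trace_smul, trace_sum, smul_eq_mul, Complex.add_re, Complex.sub_re, Complex.re_sum,
    Complex.re_ofReal_mul, Fintype.sum_sum_type, violDeriv, Sum.elim_inl, Sum.elim_inr]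
  have h2 : ∀ y : ℂ, ((2 : ℂ) * y).re = 2 * y.re := fun y => by simp
  have hg : ∀ j, (vecMulVec (D.h j) (star (D.h j)) * M).trace.re = D.sdpGain j M := fun _ => rfl
  simp only [h2, hg, mul_sub, sub_mul, Finset.sum_sub_distrib, mul_ite, mul_zero,
    Finset.sum_ite_eq', Finset.mem_univ, if_true, mul_neg, Finset.sum_neg_distrib, mul_assoc,
    Complex.sub_re]
  ring_nf

theorem re_trace_grad_nonneg {n : ℝ} (hn : 0 ≤ n)
    {z p : (Fin K → Matrix (Fin Nt) (Fin Nt) ℂ) × (Fin K → ℝ)}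
    (hp : p ∈ baseSet Nt K) (hz : z ∈ baseSet Nt K)
    (hmin : IsLocalMinOn (fun y => proxObjective z y + n * D.penalty y) (baseSet Nt K) p)
    (k : Fin K) (M : Matrix (Fin Nt) (Fin Nt) ℂ)
    (hM : ∀ᶠ t : ℝ in 𝓝[>] 0, (p.1 k + (t : ℂ) • M).PosSemidef) :
    0 ≤ (D.grad n z p k * M).trace.re := by
  rw [re_trace_grad_mul (hp.1 k).isHermitian (hz.1 k).isHermitian]
  refine nonneg_of_penalized_min n _ (∑ i, ∑ j, ‖M i j‖ ^ 2) hn (D.viol p.1 p.2) _ ?_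
  set path : ℝ → (Fin K → Matrix (Fin Nt) (Fin Nt) ℂ) × (Fin K → ℝ) := fun t =>
    (Function.update p.1 k (p.1 k + (t : ℂ) • M), p.2)
  have hpath : Continuous path := by
    refine Continuous.prodMk (continuous_const.update k ?_) continuous_const
    exact continuous_const.add (Complex.continuous_ofReal.smul continuous_const)
  have hp0 : path 0 = p := by simp [path]
  have hmem : ∀ᶠ t in 𝓝[>] (0 : ℝ), path t ∈ baseSet Nt K := by
    filter_upwards [hM] with t ht
    refine ⟨fun j => ?_, hp.2⟩
    by_cases hjk : j = k
    · subst hjk; simpa [path] using ht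
    · simpa [path, Function.update_of_ne hjk] using hp.1 j
  have htend : Tendsto path (𝓝[>] 0) (𝓝[baseSet Nt K] p) :=
    tendsto_nhdsWithin_iff.2
      ⟨(hp0 ▸ hpath.tendsto 0 : Tendsto path (𝓝 0) (𝓝 p)).mono_left nhdsWithin_le_nhds, hmem⟩
  filter_upwards [htend.eventually hmin] with t ht
  simp only [path, penalty, proxObjective, viol_update, sdpPower_update] at ht
  rw [Fintype.sum_apply_update (fun k (V : Matrix (Fin Nt) (Fin Nt) ℂ) =>
    ∑ i, ∑ j, ‖(V - z.1 k) i j‖ ^ 2)] at ht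
  rw [add_sub_right_comm, Matrix.sum_norm_sq_add_smul] at ht
  linarith

/-- Stationarity in ρ_k. Only the decreasing direction is tested: it stays in [0, 1] even when ρ_k =
1, and gives the upper bound on the harvesting multiplier. -/
theorem harvest_multiplier_le {n : ℝ} (hn : 0 ≤ n)
    {z p : (Fin K → Matrix (Fin Nt) (Fin Nt) ℂ) × (Fin K → ℝ)}
    (hp : p ∈ baseSet Nt K)
    (hmin : IsLocalMinOn (fun y => proxObjective z y + n * D.penalty y) (baseSet Nt K) p)
    (k : Fin K) (hk : 0 < p.2 k) :
    D.multiplier n p (Sum.inr (Sum.inl k)) * (∑ j, D.sdpGain k (p.1 j) + D.N0) ≤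
      D.multiplier n p (Sum.inl k) *
        (D.sinrCoef k * D.sdpGain k (p.1 k) - ∑ j, D.sdpGain k (p.1 j) - D.N0)
      + 2 * (z.2 k - p.2 k) := by
  set R := D.sinrCoef k * D.sdpGain k (p.1 k) - ∑ j, D.sdpGain k (p.1 j) - D.N0 with hR
  set T := ∑ j, D.sdpGain k (p.1 j) + D.N0 with hT
  -- Derivative of the constraint functions as ρ_k decreases.
  set b : Fin K ⊕ Fin K ⊕ Fin L → ℝ := Sum.elim (fun j => if j = k then R else 0)
    (Sum.elim (fun j => if j = k then -T else 0) (fun _ => 0)) with hb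
  have hkey : 0 ≤ -(2 * (p.2 k - z.2 k)) + ∑ i, 2 * n * max (D.viol p.1 p.2 i) 0 * b i := by
    refine nonneg_of_penalized_min n _ 1 hn (D.viol p.1 p.2) _ ?_
    set path : ℝ → (Fin K → Matrix (Fin Nt) (Fin Nt) ℂ) × (Fin K → ℝ) := fun t =>
      (p.1, Function.update p.2 k (p.2 k - t))
    have hpath : Continuous path :=
      Continuous.prodMk continuous_const (continuous_const.update k (by fun_prop))
    have hp0 : path 0 = p := by simp [path]
    have hmem : ∀ᶠ t in 𝓝[>] (0 : ℝ), path t ∈ baseSet Nt K := by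
      filter_upwards [self_mem_nhdsWithin, nhdsWithin_le_nhds (Iio_mem_nhds hk)] with t ht ht2
      have ht : 0 < t := ht
      have ht2 : t < p.2 k := ht2
      refine ⟨hp.1, fun j => ?_⟩
      by_cases hjk : j = k
      · subst hjk
        have := (hp.2 j).2
        simp only [path, Function.update_self, Set.mem_Icc]
        constructor <;> linarith
      · simpa only [path, Function.update_of_ne hjk] using hp.2 j
    have htend : Tendsto path (𝓝[>] 0) (𝓝[baseSet Nt K] p) :=
      tendsto_nhdsWithin_iff.2
        ⟨(hp0 ▸ hpath.tendsto 0 : Tendsto path (𝓝 0) (𝓝 p)).mono_left nhdsWithin_le_nhds, hmem⟩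
    have hv : ∀ t i, D.viol p.1 (Function.update p.2 k (p.2 k - t)) i =
        D.viol p.1 p.2 i + t * b i := by
      intro t i
      rcases i with j | j | l
      · by_cases hjk : j = k
        · subst hjk
          simp only [viol, hb, Sum.elim_inl, Function.update_self, if_true, hR]
          ring
        · simp [viol, hb, hjk]
      · by_cases hjk : j = k
        · subst hjk
          simp only [viol, hb, Sum.elim_inl, Sum.elim_inr, Function.update_self, if_true, hT]
          ring
        · simp [viol, hb, hjk]
      · simp [viol, hb]
    filter_upwards [htend.eventually hmin] with t ht
    simp only [path, penalty, proxObjective, hv] at ht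
    rw [Fintype.sum_apply_update (fun k r => (r - z.2 k) ^ 2)] at ht
    nlinarith
  simp only [Fintype.sum_sum_type, hb, Sum.elim_inl, Sum.elim_inr, mul_ite, mul_zero,
    Finset.sum_ite_eq', Finset.mem_univ, if_true, Finset.sum_const_zero] at hkey
  simp only [multiplier]
  linarith

end SwiptData

/-! ### Dual matrices and the rank bound at penalized minimizers -/

namespace SwiptData

variable {Nt K L : ℕ} {D : SwiptData Nt K L}

theorem gain_nonneg (k : Fin K) (x : Fin Nt → ℂ) : 0 ≤ D.gain k x := by
  unfold gain; positivity

theorem re_trace_gradBase_mul (n : ℝ) (z p : (Fin K → Matrix (Fin Nt) (Fin Nt) ℂ) × (Fin K → ℝ))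
    (k : Fin K) (x : Fin Nt → ℂ) :
    (D.gradBase n z p k * vecMulVec x (star x)).trace.re = ∑ i, ‖x i‖ ^ 2
      + 2 * (star x ⬝ᵥ ((p.1 k - z.1 k) *ᵥ x)).re
      + ∑ j, (D.multiplier n p (Sum.inl j) * p.2 j
        - D.multiplier n p (Sum.inr (Sum.inl j)) * (1 - p.2 j)) * D.gain j x
      + ∑ l, D.multiplier n p (Sum.inr (Sum.inr l)) * (star x ⬝ᵥ (D.A l *ᵥ x)).re := by
  have hg : ∀ j, (vecMulVec (D.h j) (star (D.h j)) * vecMulVec x (star x)).trace.re = D.gain j x :=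
    fun j => D.sdpGain_vecMulVec j x
  have h2 : ∀ y : ℂ, ((2 : ℂ) * y).re = 2 * y.re := fun y => by simp
  simp only [gradBase, add_mul, Finset.sum_mul, Matrix.smul_mul, trace_add, trace_smul, trace_sum,
    smul_eq_mul, Complex.add_re, Complex.re_sum, Complex.re_ofReal_mul, hg, h2,
    re_trace_mul_vecMulVec_star, one_mulVec, re_star_dotProduct_self]

theorem re_trace_grad_mul_vecMulVec (n : ℝ)
    (z p : (Fin K → Matrix (Fin Nt) (Fin Nt) ℂ) × (Fin K → ℝ)) (k : Fin K) (x : Fin Nt → ℂ) :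
    (D.grad n z p k * vecMulVec x (star x)).trace.re =
      (D.gradBase n z p k * vecMulVec x (star x)).trace.re
        - D.multiplier n p (Sum.inl k) * p.2 k * D.sinrCoef k * D.gain k x := by
  rw [grad, sub_mul, trace_sub, Matrix.smul_mul, trace_smul, smul_eq_mul, Complex.sub_re,
    Complex.re_ofReal_mul]
  congr 2
  exact D.sdpGain_vecMulVec k x

theorem isHermitian_grad (hA : ∀ l, (D.A l).PosSemidef) (n : ℝ)
    {z p : (Fin K → Matrix (Fin Nt) (Fin Nt) ℂ) × (Fin K → ℝ)}
    (hp : p ∈ baseSet Nt K) (hz : z ∈ baseSet Nt K) (k : Fin K) :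
    (D.grad n z p k).IsHermitian := by
  have hsm : ∀ (r : ℝ) {M : Matrix (Fin Nt) (Fin Nt) ℂ}, M.IsHermitian →
      ((r : ℂ) • M).IsHermitian := fun r M hM => by
    rw [IsHermitian, conjTranspose_smul, hM.eq, RCLike.star_def, Complex.conj_ofReal]
  have hh : ∀ j, (vecMulVec (D.h j) (star (D.h j))).IsHermitian := fun j =>
    (posSemidef_vecMulVec_self_star _).isHermitian
  have hsum : ∀ {ι : Type} [Fintype ι] (f : ι → Matrix (Fin Nt) (Fin Nt) ℂ),
      (∀ i, (f i).IsHermitian) → (∑ i, f i).IsHermitian := fun f hf => by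
    rw [IsHermitian, conjTranspose_sum]
    exact Finset.sum_congr rfl fun i _ => hf i
  refine IsHermitian.sub (((isHermitian_one.add ?_).add ?_).add ?_) (hsm _ (hh k))
  · exact_mod_cast hsm 2 ((hp.1 k).isHermitian.sub (hz.1 k).isHermitian)
  · exact hsum _ fun j => hsm _ (hh j)
  · exact hsum _ fun l => hsm _ (hA l).isHermitian

theorem posSemidef_grad (hA : ∀ l, (D.A l).PosSemidef) {n : ℝ} (hn : 0 ≤ n)
    {z p : (Fin K → Matrix (Fin Nt) (Fin Nt) ℂ) × (Fin K → ℝ)}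
    (hp : p ∈ baseSet Nt K) (hz : z ∈ baseSet Nt K)
    (hmin : IsLocalMinOn (fun y => proxObjective z y + n * D.penalty y) (baseSet Nt K) p)
    (k : Fin K) : (D.grad n z p k).PosSemidef := by
  refine posSemidef_of_re_nonneg (isHermitian_grad hA n hp hz k) fun x => ?_
  rw [← re_trace_mul_vecMulVec_star]
  refine re_trace_grad_nonneg hn hp hz hmin k _ ?_
  filter_upwards [self_mem_nhdsWithin] with t ht
  exact (hp.1 k).add ((posSemidef_vecMulVec_self_star x).smul
    (Complex.zero_le_real.2 (le_of_lt ht)))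

theorem grad_mul_eq_zero (hA : ∀ l, (D.A l).PosSemidef) {n : ℝ} (hn : 0 ≤ n)
    {z p : (Fin K → Matrix (Fin Nt) (Fin Nt) ℂ) × (Fin K → ℝ)}
    (hp : p ∈ baseSet Nt K) (hz : z ∈ baseSet Nt K)
    (hmin : IsLocalMinOn (fun y => proxObjective z y + n * D.penalty y) (baseSet Nt K) p)
    (k : Fin K) : D.grad n z p k * p.1 k = 0 := by
  refine (posSemidef_grad hA hn hp hz hmin k).mul_eq_zero_of_re_trace_nonpos (hp.1 k) ?_
  -- Shrinking W_k towards 0 stays in the cone for t < 1, which gives the reverse trace inequality.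
  have := re_trace_grad_nonneg hn hp hz hmin k (-(p.1 k)) (by
    filter_upwards [nhdsWithin_le_nhds (Iio_mem_nhds one_pos)] with t ht
    have ht : t < 1 := ht
    have : p.1 k + (t : ℂ) • -(p.1 k) = ((1 - t : ℝ) : ℂ) • p.1 k := by
      push_cast; rw [sub_smul, one_smul, smul_neg, sub_eq_add_neg]
    rw [this]
    exact (hp.1 k).smul (Complex.zero_le_real.2 (by linarith)))
  simpa using this

/-- Size of the perturbation of the dual matrices at `p`, relative to the reference point `z`. -/
noncomputable def slack (D : SwiptData Nt K L) (κ : Fin K → ℝ)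
    (z p : (Fin K → Matrix (Fin Nt) (Fin Nt) ℂ) × (Fin K → ℝ)) : ℝ :=
  ∑ k, 2 * ∑ i, ∑ j, ‖(p.1 k - z.1 k) i j‖ + ∑ m, (2 * (κ m / D.N0) *
    ∑ k, 2 * ∑ i, ∑ j, ‖(p.1 k - z.1 k) i j‖ + 2 * |z.2 m - p.2 m| / D.N0 * ∑ i, ‖D.h m i‖ ^ 2)

theorem one_le_sinrCoef (hgam : ∀ k, 0 < D.gam k) (k : Fin K) : 1 ≤ D.sinrCoef k := by
  rw [sinrCoef, le_div_iff₀ (hgam k)]; linarith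

/-- This is `pos_of_dominated` with X = ‖x‖², a the SINR and b the harvesting coefficients, e the
proximal error and s the SAR term. Dropping S_j ≥ 0 and N_0 > 0 from `harvest_multiplier_le` gives
β_j N_0 ≤ κ_j α_j ρ_j + 2 |z_j - ρ_j|, hence the bound on b. -/
theorem re_trace_gradBase_pos (hN0 : 0 < D.N0) (hgam : ∀ k, 0 < D.gam k)
    (hA : ∀ l, (D.A l).PosSemidef) {n : ℝ} (hn : 0 ≤ n)
    {z p : (Fin K → Matrix (Fin Nt) (Fin Nt) ℂ) × (Fin K → ℝ)}
    (hp : p ∈ baseSet Nt K) (hz : z ∈ baseSet Nt K)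
    (hmin : IsLocalMinOn (fun y => proxObjective z y + n * D.penalty y) (baseSet Nt K) p)
    (hpos : ∀ k, 0 < p.2 k) {κ : Fin K → ℝ}
    (hκ : ∀ k, D.sinrCoef k * D.sdpGain k (p.1 k) < κ k * p.2 k) (hsmall : D.slack κ z p < 1)
    (k : Fin K) {x : Fin Nt → ℂ} (hx : x ≠ 0) :
    0 < (D.gradBase n z p k * vecMulVec x (star x)).trace.re := by
  have hm := D.multiplier_nonneg hn p
  have hS : ∀ k, 0 ≤ ∑ j, D.sdpGain k (p.1 j) := fun k =>
    Finset.sum_nonneg fun j _ => D.sdpGain_nonneg k (hp.1 j)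
  have hc := one_le_sinrCoef hgam
  have hκ0 : ∀ k, 0 ≤ κ k := fun k => by
    have h1 : 0 ≤ D.sinrCoef k * D.sdpGain k (p.1 k) :=
      mul_nonneg (by linarith [hc k]) (D.sdpGain_nonneg k (hp.1 k))
    exact (pos_of_mul_pos_left (h1.trans_lt (hκ k)) (hpos k).le).le
  rw [re_trace_gradBase_mul]
  refine pos_of_dominated (∑ i, ‖x i‖ ^ 2) _ (fun k => 2 * (star x ⬝ᵥ ((p.1 k - z.1 k) *ᵥ x)).re)
    (fun k => 2 * ∑ i, ∑ j, ‖(p.1 k - z.1 k) i j‖) (fun j => D.multiplier n p (Sum.inl j) * p.2 j)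
    (fun j => D.multiplier n p (Sum.inr (Sum.inl j)) * (1 - p.2 j)) D.sinrCoef
    (fun j => D.gain j x) (fun j => ∑ i, ‖D.h j i‖ ^ 2) (fun j => κ j / D.N0)
    (fun j => 2 * |z.2 j - p.2 j| / D.N0) ?_ ?_ ?_ ?_ (fun j => gain_nonneg j x) ?_ ?_ ?_ ?_ ?_ hc
    ?_ hsmall k
  · obtain ⟨i, hi⟩ := Function.ne_iff.1 hx
    exact Finset.sum_pos' (fun i _ => by positivity)
      ⟨i, Finset.mem_univ i, by have := norm_pos_iff.2 hi; positivity⟩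
  · exact Finset.sum_nonneg fun l _ => mul_nonneg (hm _) ((hA l).re_dotProduct_nonneg x)
  · intro j
    have := abs_re_star_dotProduct_mulVec_le (p.1 j - z.1 j) x
    rw [abs_mul, abs_two]
    linarith
  · intro j; positivity
  · intro j; exact norm_star_dotProduct_sq_le (D.h j) x
  · intro j; exact mul_nonneg (hm _) (hpos j).le
  · intro j
    have h1 := harvest_multiplier_le hn hp hmin j (hpos j)
    have h2 := mul_nonneg (hm (Sum.inr (Sum.inl j))) (hpos j).le
    have h3 := mul_nonneg (hm (Sum.inr (Sum.inl j))) (hS j)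
    have h4 : D.multiplier n p (Sum.inl j) *
        (D.sinrCoef j * D.sdpGain j (p.1 j) - ∑ i, D.sdpGain j (p.1 i) - D.N0) ≤
        D.multiplier n p (Sum.inl j) * (κ j * p.2 j) :=
      mul_le_mul_of_nonneg_left (by linarith [hκ j, hS j]) (hm _)
    have h5 := le_abs_self (z.2 j - p.2 j)
    have h6 : D.multiplier n p (Sum.inr (Sum.inl j)) ≤
        (κ j * (D.multiplier n p (Sum.inl j) * p.2 j) + 2 * |z.2 j - p.2 j|) / D.N0 := by
      rw [le_div_iff₀ hN0]; linarith
    calc _ ≤ D.multiplier n p (Sum.inr (Sum.inl j)) := by linarith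
      _ ≤ _ := h6
      _ = _ := by ring
  · intro j; exact div_nonneg (hκ0 j) hN0.le
  · intro j; positivity
  · intro j
    have h1 := (posSemidef_grad hA hn hp hz hmin j).re_dotProduct_nonneg x
    have h2 : 0 ≤ (D.grad n z p j * vecMulVec x (star x)).trace.re := by
      rw [re_trace_mul_vecMulVec_star]; exact h1
    rw [re_trace_grad_mul_vecMulVec, re_trace_gradBase_mul] at h2
    linarith

/-- With P = `p.1 k`, the identity says that P has rank at most one when h†Ph ≠ 0, and it is a
closed condition on P. It holds because a vector Py orthogonal to h lies in the kernel of `grad`,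
where `gradBase` and `grad` have the same quadratic form; positivity of `gradBase` forces Py = 0. -/
theorem smul_eq_vecMulVec_of_isLocalMinOn (hN0 : 0 < D.N0) (hgam : ∀ k, 0 < D.gam k)
    (hA : ∀ l, (D.A l).PosSemidef) {n : ℝ} (hn : 0 ≤ n)
    {z p : (Fin K → Matrix (Fin Nt) (Fin Nt) ℂ) × (Fin K → ℝ)}
    (hp : p ∈ baseSet Nt K) (hz : z ∈ baseSet Nt K)
    (hmin : IsLocalMinOn (fun y => proxObjective z y + n * D.penalty y) (baseSet Nt K) p)
    (hpos : ∀ k, 0 < p.2 k) {κ : Fin K → ℝ}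
    (hκ : ∀ k, D.sinrCoef k * D.sdpGain k (p.1 k) < κ k * p.2 k) (hsmall : D.slack κ z p < 1)
    (k : Fin K) :
    (star (D.h k) ⬝ᵥ (p.1 k *ᵥ D.h k)) • p.1 k =
      vecMulVec (p.1 k *ᵥ D.h k) (star (D.h k) ᵥ* p.1 k) := by
  have hker : ∀ y, star (D.h k) ⬝ᵥ (p.1 k *ᵥ y) = 0 → p.1 k *ᵥ y = 0 := by
    intro y hy
    by_contra hne
    have h1 := re_trace_gradBase_pos hN0 hgam hA hn hp hz hmin hpos hκ hsmall k hne
    have h2 := D.re_trace_grad_mul_vecMulVec n z p k (p.1 k *ᵥ y)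
    have h3 : D.gain k (p.1 k *ᵥ y) = 0 := by rw [gain, hy]; simp
    have h4 : D.grad n z p k *ᵥ (p.1 k *ᵥ y) = 0 := by
      rw [mulVec_mulVec, grad_mul_eq_zero hA hn hp hz hmin k, zero_mulVec]
    rw [mul_vecMulVec, h4, zero_vecMulVec, trace_zero, h3] at h2
    simp only [Complex.zero_re, mul_zero, sub_zero] at h2
    linarith
  refine ext_of_mulVec_single fun j => ?_
  -- This combination of e_j and h is chosen so that h†P kills it; Py = 0 is then the j-th column of
  -- the identity.
  have := hker ((star (D.h k) ⬝ᵥ (p.1 k *ᵥ D.h k)) • Pi.single j 1 -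
    (star (D.h k) ⬝ᵥ (p.1 k *ᵥ Pi.single j 1)) • D.h k) (by
      simp only [mulVec_sub, mulVec_smul, dotProduct_sub, dotProduct_smul, smul_eq_mul]; ring)
  rw [mulVec_sub, mulVec_smul, mulVec_smul, sub_eq_zero] at this
  rw [smul_mulVec, this, vecMulVec_mulVec, ← dotProduct_mulVec]
  ext i
  simp [mul_comm]

/-! ### Passage from penalized minimizers to the optimum -/

theorem continuous_slack (κ : Fin K → ℝ)
    (z : (Fin K → Matrix (Fin Nt) (Fin Nt) ℂ) × (Fin K → ℝ)) : Continuous (D.slack κ z) := by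
  have h : ∀ k i j, Continuous fun p : (Fin K → Matrix (Fin Nt) (Fin Nt) ℂ) × (Fin K → ℝ) =>
      (p.1 k - z.1 k) i j := fun k i j =>
    Continuous.matrix_elem (Continuous.sub (by fun_prop) continuous_const) i j
  unfold slack
  fun_prop

theorem continuous_proxObjective
    (z : (Fin K → Matrix (Fin Nt) (Fin Nt) ℂ) × (Fin K → ℝ)) : Continuous (proxObjective z) := by
  have h : ∀ k i j, Continuous fun p : (Fin K → Matrix (Fin Nt) (Fin Nt) ℂ) × (Fin K → ℝ) =>
      (p.1 k - z.1 k) i j := fun k i j =>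
    Continuous.matrix_elem (Continuous.sub (by fun_prop) continuous_const) i j
  have h0 : Continuous fun p : (Fin K → Matrix (Fin Nt) (Fin Nt) ℂ) × (Fin K → ℝ) =>
      sdpPower p.1 := continuous_sdpPower.comp continuous_fst
  unfold proxObjective
  fun_prop

theorem continuous_penalty : Continuous D.penalty := by
  have := D.continuous_viol
  unfold penalty
  fun_prop

theorem penalty_eq_zero_iff (p : (Fin K → Matrix (Fin Nt) (Fin Nt) ℂ) × (Fin K → ℝ)) :
    D.penalty p = 0 ↔ ∀ i, D.viol p.1 p.2 i ≤ 0 := by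
  rw [penalty, Finset.sum_eq_zero_iff_of_nonneg fun i _ => by positivity]
  simp

theorem eq_of_proxObjective_le {z p : (Fin K → Matrix (Fin Nt) (Fin Nt) ℂ) × (Fin K → ℝ)}
    (hpow : sdpPower z.1 ≤ sdpPower p.1) (h : proxObjective z p ≤ proxObjective z z) : p = z := by
  simp only [proxObjective, sub_self, Matrix.zero_apply, norm_zero, ne_eq, OfNat.ofNat_ne_zero,
    not_false_eq_true, zero_pow, Finset.sum_const_zero, add_zero] at h
  have h1 : 0 ≤ ∑ k, ∑ i, ∑ j, ‖(p.1 k - z.1 k) i j‖ ^ 2 := by positivity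
  have h2 : 0 ≤ ∑ k, (p.2 k - z.2 k) ^ 2 := by positivity
  have h3 : ∑ k, ∑ i, ∑ j, ‖(p.1 k - z.1 k) i j‖ ^ 2 = 0 := by linarith
  have h4 : ∑ k, (p.2 k - z.2 k) ^ 2 = 0 := by linarith
  refine Prod.ext (funext fun k => ?_) (funext fun k => ?_)
  · ext i j
    rw [Finset.sum_eq_zero_iff_of_nonneg fun _ _ => by positivity] at h3
    have h5 := h3 k (Finset.mem_univ k)
    rw [Finset.sum_eq_zero_iff_of_nonneg fun _ _ => by positivity] at h5
    have h6 := h5 i (Finset.mem_univ i)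
    rw [Finset.sum_eq_zero_iff_of_nonneg fun _ _ => by positivity] at h6
    have h7 := h6 j (Finset.mem_univ j)
    rw [pow_eq_zero_iff two_ne_zero, norm_eq_zero, Matrix.sub_apply, sub_eq_zero] at h7
    exact h7
  · rw [Finset.sum_eq_zero_iff_of_nonneg fun _ _ => by positivity] at h4
    have h5 := h4 k (Finset.mem_univ k)
    rw [pow_eq_zero_iff two_ne_zero, sub_eq_zero] at h5
    exact h5

theorem SdpOptimal.smul_eq_vecMulVec (hN0 : 0 < D.N0) (hNC : ∀ k, 0 < D.NC k)
    (hgam : ∀ k, 0 < D.gam k) (hlam : ∀ k, 0 < D.lam k) (hA : ∀ l, (D.A l).PosSemidef)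
    {W : Fin K → Matrix (Fin Nt) (Fin Nt) ℂ} {ρ : Fin K → ℝ} (hopt : D.SdpOptimal W ρ)
    (k : Fin K) :
    (star (D.h k) ⬝ᵥ (W k *ᵥ D.h k)) • W k = vecMulVec (W k *ᵥ D.h k) (star (D.h k) ᵥ* W k) := by
  by_contra hcon
  have hfeas := fun W ρ => D.sdpFeasible_iff hN0 hNC hgam hlam W ρ
  obtain ⟨hzS, hzv⟩ := (hfeas W ρ).1 hopt.1
  -- The summand 1 makes the bound strict at the optimum, hence valid nearby.
  set κ : Fin K → ℝ := fun k => D.sinrCoef k * D.sdpGain k (W k) / ρ k + 1 with hκ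
  -- If the identity failed at the optimum it would fail on this whole neighbourhood, yet some
  -- penalized minimizer in it satisfies the identity.
  set V : Set ((Fin K → Matrix (Fin Nt) (Fin Nt) ℂ) × (Fin K → ℝ)) :=
    {p | ∀ k, 0 < p.2 k} ∩ {p | ∀ k, D.sinrCoef k * D.sdpGain k (p.1 k) < κ k * p.2 k} ∩
      {p | D.slack κ (W, ρ) p < 1} ∩
      {p | (star (D.h k) ⬝ᵥ (p.1 k *ᵥ D.h k)) • p.1 k ≠
        vecMulVec (p.1 k *ᵥ D.h k) (star (D.h k) ᵥ* p.1 k)} with hV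
  have hW : ∀ k, Continuous fun p : (Fin K → Matrix (Fin Nt) (Fin Nt) ℂ) × (Fin K → ℝ) => p.1 k :=
    fun k => by fun_prop
  have hVopen : IsOpen V := by
    refine (((?_ : IsOpen _).inter ?_).inter ?_).inter ?_
    · rw [Set.ofPred_forall]
      exact isOpen_iInter_of_finite fun k => isOpen_lt continuous_const (by fun_prop)
    · rw [Set.ofPred_forall]
      exact isOpen_iInter_of_finite fun k => isOpen_lt
        (continuous_const.mul ((D.continuous_sdpGain k).comp (hW k))) (by fun_prop)
    · exact isOpen_lt (continuous_slack κ (W, ρ)) continuous_const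
    · have h1 := (hW k).matrix_mulVec (continuous_const (y := D.h k))
      exact isOpen_ne_fun (((continuous_const (y := star (D.h k))).dotProduct h1).smul (hW k))
        (h1.matrix_vecMulVec ((continuous_const (y := star (D.h k))).matrix_vecMul (hW k)))
  have hVz : (W, ρ) ∈ V := by
    refine ⟨⟨⟨hopt.1.rho_pos, fun k => ?_⟩, ?_⟩, hcon⟩
    · have := hopt.1.rho_pos k
      simp only [hκ, add_mul, div_mul_cancel₀ _ this.ne']
      linarith
    · simp [slack]
  have : LocallyCompactSpace (Matrix (Fin Nt) (Fin Nt) ℂ) :=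
    inferInstanceAs (LocallyCompactSpace (Fin Nt → Fin Nt → ℂ))
  obtain ⟨n, hn, p, ⟨⟨⟨⟨hp1, hp2⟩, hp3⟩, hp4⟩, hpS⟩, hmin⟩ :=
    exists_isLocalMinOn_penalized isClosed_baseSet (continuous_proxObjective (W, ρ))
      (continuous_penalty (D := D)) (fun p => by unfold penalty; positivity) hzS
      ((penalty_eq_zero_iff _).2 hzv)
      (fun p hp hGp hle => eq_of_proxObjective_le
        (hopt.2 _ _ ((hfeas p.1 p.2).2 ⟨hp, (penalty_eq_zero_iff p).1 hGp⟩)) hle)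
      (hVopen.mem_nhds hVz)
  exact hp4 (smul_eq_vecMulVec_of_isLocalMinOn hN0 hgam hA hn hpS hzS hmin hp1 hp2 hp3 k)

end SwiptData

/-! ### Eigenvectors of rank-one matrices -/

/-- With c = v†u, the eigenvalue equation reads c v = μ u, and pairing with u gives |c|² = μ. Hence
μ v v† = μ² u u†, whatever the phase of u. -/
theorem IsEigenBeamformer.vecMulVec_eq {n : ℕ} {v w : Fin n → ℂ}
    (h : IsEigenBeamformer (vecMulVec v (star v)) w) :
    vecMulVec w (star w) = vecMulVec v (star v) := by
  obtain ⟨μ, u, hμ, hu, hvu, rfl⟩ := h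
  set c := star v ⬝ᵥ u with hc
  have hμ0 : (μ : ℂ) ≠ 0 := by exact_mod_cast hμ.ne'
  have hcv : c • v = (μ : ℂ) • u := by
    rw [← hvu, vecMulVec_mulVec]; simp [hc]
  have huu : star u ⬝ᵥ u = 1 := by
    have h1 : (star u ⬝ᵥ u).im = 0 := by
      have := dotProduct_star_self_nonneg (star u)
      rw [star_star, dotProduct_comm] at this
      exact (Complex.le_def.1 this).2.symm
    exact Complex.ext (by rw [re_star_dotProduct_self, hu]; rfl) h1
  have hcc : c * star c = μ := by
    have := congrArg (fun y => star u ⬝ᵥ y) hcv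
    simp only [dotProduct_smul, huu, smul_eq_mul, mul_one] at this
    rw [← this, star_dotProduct u v]
  have hsq : ((Real.sqrt μ : ℝ) : ℂ) * ((Real.sqrt μ : ℝ) : ℂ) = μ := by
    exact_mod_cast Real.mul_self_sqrt hμ.le
  have h1 : (μ : ℂ) • vecMulVec v (star v) =
      ((μ : ℂ) * μ) • vecMulVec u (star u) := by
    have h2 : vecMulVec (c • v) (star (c • v)) =
        vecMulVec ((μ : ℂ) • u) (star ((μ : ℂ) • u)) := by rw [hcv]
    rw [star_smul, star_smul, smul_vecMulVec, smul_vecMulVec, vecMulVec_smul, vecMulVec_smul,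
      smul_smul, smul_smul, hcc, RCLike.star_def, Complex.conj_ofReal] at h2
    exact h2
  rw [mul_smul] at h1
  rw [smul_right_injective _ hμ0 h1, star_smul, smul_vecMulVec, vecMulVec_smul, smul_smul,
    RCLike.star_def, Complex.conj_ofReal, hsq]

theorem exists_isEigenBeamformer_vecMulVec {n : ℕ} {v : Fin n → ℂ} (hv : v ≠ 0) :
    ∃ w, IsEigenBeamformer (vecMulVec v (star v)) w := by
  set s := ∑ i, ‖v i‖ ^ 2 with hs
  have hs0 : 0 < s := by
    obtain ⟨i, hi⟩ := Function.ne_iff.1 hv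
    exact Finset.sum_pos' (fun i _ => by positivity)
      ⟨i, Finset.mem_univ i, by have := norm_pos_iff.2 hi; positivity⟩
  have hvv : star v ⬝ᵥ v = (s : ℂ) := by
    have := dotProduct_star_self_nonneg (star v)
    rw [star_star, dotProduct_comm] at this
    exact Complex.ext (by rw [re_star_dotProduct_self, Complex.ofReal_re])
      (by rw [Complex.ofReal_im]; exact (Complex.le_def.1 this).2.symm)
  refine ⟨_, s, ((Real.sqrt s)⁻¹ : ℂ) • v, hs0, ?_, ?_, rfl⟩
  · simp only [Pi.smul_apply, smul_eq_mul, norm_mul, norm_inv, Complex.norm_real, mul_pow,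
      ← Finset.mul_sum, Real.norm_eq_abs, inv_pow, sq_abs, Real.sq_sqrt hs0.le]
    exact inv_mul_cancel₀ hs0.ne'
  · rw [mulVec_smul, vecMulVec_mulVec, hvv, smul_comm]
    simp

theorem Matrix.rank_vecMulVec_star_self {n : ℕ} {v : Fin n → ℂ} (hv : v ≠ 0) :
    (vecMulVec v (star v)).rank = 1 := by
  refine le_antisymm (rank_vecMulVec_le _ _) (Nat.one_le_iff_ne_zero.2 fun h => ?_)
  rw [rank, Submodule.finrank_eq_zero, LinearMap.range_eq_bot] at h
  have := LinearMap.congr_fun h v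
  simp [vecMulVec_mulVec, hv] at this

/-! ### Transfer to the beamforming problem -/

namespace SwiptData

variable {Nt K L : ℕ} {D : SwiptData Nt K L}

theorem sdpPower_vecMulVec (w : Fin K → Fin Nt → ℂ) :
    sdpPower (fun k => vecMulVec (w k) (star (w k))) = beamPower w := by
  simp only [sdpPower, beamPower, trace_vecMulVec]
  exact Finset.sum_congr rfl fun k _ => by rw [dotProduct_comm, re_star_dotProduct_self]

theorem sdpFeasible_vecMulVec_iff (hN0 : 0 < D.N0) (hNC : ∀ k, 0 < D.NC k)
    (hgam : ∀ k, 0 < D.gam k) (hlam : ∀ k, 0 < D.lam k) (w : Fin K → Fin Nt → ℂ)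
    (ρ : Fin K → ℝ) :
    D.SdpFeasible (fun k => vecMulVec (w k) (star (w k))) ρ ↔ D.BeamFeasible w ρ := by
  have key : ∀ k, 0 < ρ k → (D.gam k / (1 + D.gam k) ≤
      D.gain k (w k) / ((∑ j, D.gain k (w j)) + D.N0 + D.NC k / ρ k) ↔ D.gam k ≤
      D.gain k (w k) /
        ((∑ j ∈ Finset.univ.erase k, D.gain k (w j)) + D.N0 + D.NC k / ρ k)) := by
    intro k hρ
    have hg := hgam k
    have h1 : 0 ≤ ∑ j ∈ Finset.univ.erase k, D.gain k (w j) :=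
      Finset.sum_nonneg fun j _ => gain_nonneg k (w j)
    have h2 := gain_nonneg (D := D) k (w k)
    have h3 := div_pos (hNC k) hρ
    rw [← Finset.add_sum_erase _ _ (Finset.mem_univ k), div_le_div_iff₀ (by linarith) (by linarith),
      le_div_iff₀ (by linarith)]
    constructor <;> intro h <;> linarith
  have hS : ∀ k, 0 < (∑ j, D.gain k (w j)) + D.N0 := fun k =>
    add_pos_of_nonneg_of_pos (Finset.sum_nonneg fun j _ => gain_nonneg k (w j)) hN0
  constructor
  · intro h
    refine ⟨h.rho_pos, fun k => (h.rho_lt_one k).le, fun k => (key k (h.rho_pos k)).1 ?_,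
      fun k => ?_, fun l => ?_⟩
    · simpa only [sdpGain_vecMulVec] using h.sinr k
    · have := h.harvest k
      simp only [sdpGain_vecMulVec] at this
      rw [div_le_iff₀ (sub_pos.2 (h.rho_lt_one k))] at this
      linarith
    · simpa only [re_trace_mul_vecMulVec_star] using h.sar l
  · intro h
    -- Beamforming feasibility allows ρ = 1, but λ > 0 in the harvesting constraint excludes it.
    have h1 : ∀ k, ρ k < 1 := fun k => by
      have := pos_of_mul_pos_left ((hlam k).trans_le (h.harvest k)) (hS k).le
      linarith
    refine ⟨fun k => posSemidef_vecMulVec_self_star _, h.rho_pos, h1, fun k => ?_, fun k => ?_,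
      fun l => ?_⟩
    · simpa only [sdpGain_vecMulVec] using (key k (h.rho_pos k)).2 (h.sinr k)
    · simp only [sdpGain_vecMulVec]
      rw [div_le_iff₀ (sub_pos.2 (h1 k))]
      linarith [h.harvest k]
    · simpa only [re_trace_mul_vecMulVec_star] using h.sar l

theorem SdpFeasible.sdpGain_pos (hgam : ∀ k, 0 < D.gam k)
    {W : Fin K → Matrix (Fin Nt) (Fin Nt) ℂ} {ρ : Fin K → ℝ} (h : D.SdpFeasible W ρ)
    (k : Fin K) : 0 < D.sdpGain k (W k) := by
  refine lt_of_le_of_ne (D.sdpGain_nonneg k (h.psd k)) fun h0 => ?_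
  have h1 := h.sinr k
  have h2 := hgam k
  have : 0 < D.gam k / (1 + D.gam k) := by positivity
  rw [← h0, zero_div] at h1
  linarith

theorem SdpOptimal.exists_eq_vecMulVec (hN0 : 0 < D.N0) (hNC : ∀ k, 0 < D.NC k)
    (hgam : ∀ k, 0 < D.gam k) (hlam : ∀ k, 0 < D.lam k) (hA : ∀ l, (D.A l).PosSemidef)
    {W : Fin K → Matrix (Fin Nt) (Fin Nt) ℂ} {ρ : Fin K → ℝ} (hopt : D.SdpOptimal W ρ)
    (k : Fin K) : ∃ v : Fin Nt → ℂ, v ≠ 0 ∧ W k = vecMulVec v (star v) := by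
  have h1 := hopt.smul_eq_vecMulVec hN0 hNC hgam hlam hA k
  have h2 := hopt.1.sdpGain_pos hgam k
  have hW := hopt.1.psd k
  set s := D.sdpGain k (W k) with hs
  have h3 : star (D.h k) ⬝ᵥ (W k *ᵥ D.h k) = (s : ℂ) :=
    Complex.ext (by rw [hs, sdpGain_eq, Complex.ofReal_re])
      (by rw [Complex.ofReal_im]
          exact (Complex.le_def.1 (hW.dotProduct_mulVec_nonneg (D.h k))).2.symm)
  have hs0 : (s : ℂ) ≠ 0 := by exact_mod_cast h2.ne'
  have hsq : ((Real.sqrt s : ℝ) : ℂ) * ((Real.sqrt s : ℝ) : ℂ) = s := by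
    exact_mod_cast Real.mul_self_sqrt h2.le
  have hstar : star (D.h k) ᵥ* W k = star (W k *ᵥ D.h k) := by
    rw [star_mulVec, hW.isHermitian.eq]
  -- Divide the identity by s = h†Wh > 0, splitting 1/s as a product of two factors 1/√s.
  have h4 : W k = vecMulVec (((Real.sqrt s : ℝ) : ℂ)⁻¹ • (W k *ᵥ D.h k))
      (star (((Real.sqrt s : ℝ) : ℂ)⁻¹ • (W k *ᵥ D.h k))) := by
    rw [star_smul, smul_vecMulVec, vecMulVec_smul, smul_smul, star_inv₀, RCLike.star_def,
      Complex.conj_ofReal, ← mul_inv, hsq, ← hstar, ← h1, h3, smul_smul, inv_mul_cancel₀ hs0,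
      one_smul]
  refine ⟨_, fun h0 => ?_, h4⟩
  rw [h0, zero_vecMulVec] at h4
  rw [hs, h4] at h2
  simp [sdpGain] at h2

end SwiptData

theorem theorem2 {Nt K L : ℕ} (D : SwiptData Nt K L)
    (hN0 : 0 < D.N0) (hNC : ∀ k, 0 < D.NC k)
    (hgam : ∀ k, 0 < D.gam k) (hlam : ∀ k, 0 < D.lam k)
    (hA : ∀ l, (D.A l).PosSemidef) :
    ((∃ W ρ, D.SdpFeasible W ρ) → ∃ W ρ, D.SdpOptimal W ρ) ∧
    ∀ W ρ, D.SdpOptimal W ρ →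
      (∀ k, (W k).rank = 1) ∧
      (∀ k, ∃ w, IsEigenBeamformer (W k) w) ∧
      ∀ w : Fin K → Fin Nt → ℂ, (∀ k, IsEigenBeamformer (W k) (w k)) →
        (∀ k, W k = vecMulVec (w k) (star (w k))) ∧
        D.BeamOptimal w ρ ∧
        SwiptData.beamPower w = SwiptData.sdpPower W := by
  refine ⟨SwiptData.exists_sdpOptimal hN0 hNC hgam hlam, fun W ρ hopt => ?_⟩
  choose v hv hW using hopt.exists_eq_vecMulVec hN0 hNC hgam hlam hA
  refine ⟨fun k => ?_, fun k => ?_, fun w hw => ?_⟩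
  · rw [hW k]; exact rank_vecMulVec_star_self (hv k)
  · rw [hW k]; exact exists_isEigenBeamformer_vecMulVec (hv k)
  · have hWw : ∀ k, W k = vecMulVec (w k) (star (w k)) := fun k => by
      have := hw k
      rw [hW k] at this ⊢
      exact this.vecMulVec_eq.symm
    obtain rfl : W = fun k => vecMulVec (w k) (star (w k)) := funext hWw
    have hfeas := SwiptData.sdpFeasible_vecMulVec_iff hN0 hNC hgam hlam
    refine ⟨hWw, ⟨(hfeas w ρ).1 hopt.1, fun w' ρ' h' => ?_⟩,
      (SwiptData.sdpPower_vecMulVec w).symm⟩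
    have := hopt.2 _ _ ((hfeas w' ρ').2 h')
    rwa [SwiptData.sdpPower_vecMulVec, SwiptData.sdpPower_vecMulVec] at this
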